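/- Let $N\ge 1$ be an integer and consider the ordinary differential equation $$\varphi''+\Bigl(\frac{N-1}{r}+\frac r2\Bigr)\varphi'+e^{\varphi}+1=0,\qquad r>0. \tag{E}$$ A regular solution is a function $\varphi\in C^2([0,\infty))$ satisfying (E) and $\varphi'(0)=0$. For $L\in\mathbb R$ let $S_L$ be the set of regular solutions $\varphi$ with $\lim_{r\to\infty}(2\log r+\varphi(r))=L$. An element $\underline\varphi\in S_L$ is called a minimal solution of $S_L$ if $\underline\varphi(r)\le\varphi(r)$ for all $r\ge0$ and all $\varphi\in S_L$. Let $L\in\mathbb R$ and assume that $S_L$ has a minimal solution $\underline\varphi_L$ and another element $\varphi_L\not\equiv\underline\varphi_L$. Then: (i) If $\varphi\in S_L$ satisfies $\varphi(r)\le\varphi_L(r)$ for all $r>0$, then either $\varphi(r)=\underline\varphi_L(r)$ for all $r>0$, or $\varphi(r)=\varphi_L(r)$ for all $r>0$. (ii) If $\varphi$ is a regular solution with $\varphi(r)\ge\varphi_L(r)$ for all $r\ge0$, then $\varphi(r)=\varphi_L(r)$ for all $r\ge0$. (iii) If $L_0\le L$ and $\varphi\in S_{L_0}$ satisfies $\varphi(r)\le\underline\varphi_L(r)$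 for all $r\ge0$, then $\varphi$ is a minimal solution of $S_{L_0}$. (iv) There is no solution $\varphi\in C^2((0,\infty))$ of (E) with $\varphi(r)>\varphi_L(r)$ for all $r\in(0,\infty)$ and $\varphi(r)\to\infty$ as $r\to0^+$. -/

import Mathlib

open Filter Topology

/-- The radial self-similar profile equation
`φ'' + ((N - 1) / r + r / 2) φ' + e^φ + 1 = 0` for `r > 0`. -/
def SatisfiesProfileEq (N : ℕ) (φ : ℝ → ℝ) : Prop :=
  ∀ r : ℝ, 0 < r →
    deriv (deriv φ) r + (((N : ℝ) - 1) / r + r / 2) * deriv φ r + Real.exp (φ r) + 1 = 0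

/-- A regular solution: `φ ∈ C²([0, ∞))` solves the profile equation and `φ'(0) = 0`
(one-sided derivative). Only the values of `φ` on `[0, ∞)` matter. -/
structure IsRegularSolution (N : ℕ) (φ : ℝ → ℝ) : Prop where
  contDiffOn : ContDiffOn ℝ 2 φ (Set.Ici 0)
  satisfiesProfileEq : SatisfiesProfileEq N φ
  hasDerivWithinAt_zero : HasDerivWithinAt φ 0 (Set.Ici 0) 0

/-- A solution `φ ∈ C²((0, ∞))` of the profile equation that is singular at the origin:
`φ(r) → ∞` as `r → 0⁺`. -/
structure IsSingularSolution (N : ℕ) (φ : ℝ → ℝ) : Prop where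
  contDiffOn : ContDiffOn ℝ 2 φ (Set.Ioi 0)
  satisfiesProfileEq : SatisfiesProfileEq N φ
  tendsto_zero : Tendsto φ (𝓝[>] 0) atTop

/-- The solution set `S_L`: regular solutions with `2 log r + φ(r) → L` as `r → ∞`. -/
def solutionSet (N : ℕ) (L : ℝ) : Set (ℝ → ℝ) :=
  {φ | IsRegularSolution N φ ∧ Tendsto (fun r : ℝ => 2 * Real.log r + φ r) atTop (𝓝 L)}

/-- A minimal solution of `S_L`: an element of `S_L` lying below every element of `S_L`
on `[0, ∞)`. -/
def IsMinimalSolution (N : ℕ) (L : ℝ) (φ : ℝ → ℝ) : Prop :=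
  φ ∈ solutionSet N L ∧ ∀ ψ ∈ solutionSet N L, ∀ r : ℝ, 0 ≤ r → φ r ≤ ψ r

/-! For an ordered triple of solutions put `w = φ₂ - φ₁`, `v = φ₃ - φ₂` and `W = ρ (w' v - w v')`,
with `ρ` the integrating factor. First-order terms cancel in `W'`, and strict convexity of `exp`
makes `W` strictly increasing while `w, v > 0`. At infinity, if `φ₁` and `φ₂` share the constant
`L`, then `w` decays so fast that `ρ w` is bounded; `W ≥ 0` at some point would then force `v` to
decrease at least linearly and change sign. So `W < 0` (`diffWronskian_neg`). At the origin, `W → 0`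
for regular solutions, so increase gives `W > 0`, a contradiction. If `w` changes sign, its zeros
replace the endpoints (`le_of_lt_of_tendsto`). With uniqueness at a touching point this yields
(i)-(iii). For (iv), `W < 0` everywhere makes `v / w` increasing, which bounds `φ₃` near the origin
(`exists_diffWronskian_nonneg`). -/

/-- The coefficient `(N - 1) / r + r / 2` of the first-order term in the profile equation. -/
noncomputable def profileDrift (N : ℕ) (r : ℝ) : ℝ := ((N : ℝ) - 1) / r + r / 2

/-- The integrating factor `r ^ (N - 1) * exp (r ^ 2 / 4)` of the profile equation. -/
noncomputable def profileWeight (N : ℕ) (r : ℝ) : ℝ := r ^ (N - 1) * Real.exp (r ^ 2 / 4)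

/-- Solutions of the profile equation on `(0, ∞)`, as a statement about derivatives. -/
def IsProfileSolutionOnPos (N : ℕ) (φ : ℝ → ℝ) : Prop :=
  ∀ r : ℝ, 0 < r → HasDerivAt φ (deriv φ r) r ∧
    HasDerivAt (deriv φ) (-(profileDrift N r * deriv φ r) - Real.exp (φ r) - 1) r

/-- The weighted Wronskian of the differences `φ₂ - φ₁` and `φ₃ - φ₂`. -/
noncomputable def diffWronskian (N : ℕ) (φ₁ φ₂ φ₃ : ℝ → ℝ) (r : ℝ) : ℝ :=
  profileWeight N r * ((deriv φ₂ r - deriv φ₁ r) * (φ₃ r - φ₂ r) -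
    (φ₂ r - φ₁ r) * (deriv φ₃ r - deriv φ₂ r))

/-! ### The integrating factor and solutions near the origin. -/

theorem profileWeight_pos (N : ℕ) {r : ℝ} (hr : 0 < r) : 0 < profileWeight N r := by
  unfold profileWeight; positivity

theorem continuous_profileWeight (N : ℕ) : Continuous (profileWeight N) := by
  unfold profileWeight; fun_prop

theorem hasDerivAt_profileWeight {N : ℕ} (hN : 1 ≤ N) {r : ℝ} (hr : 0 < r) :
    HasDerivAt (profileWeight N) (profileDrift N r * profileWeight N r) r := by
  obtain ⟨n, rfl⟩ : ∃ n, N = n + 1 := ⟨N - 1, by omega⟩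
  have h1 : HasDerivAt (fun x : ℝ => x ^ n) (n * r ^ (n - 1)) r := hasDerivAt_pow n r
  have h2 : HasDerivAt (fun x : ℝ => Real.exp (x ^ 2 / 4)) (Real.exp (r ^ 2 / 4) * (r / 2)) r := by
    have := ((hasDerivAt_pow 2 r).div_const 4).exp
    exact this.congr_deriv (by norm_num; ring)
  have h3 : (n : ℝ) * r ^ (n - 1) = n / r * r ^ n := by
    rcases n with _ | n
    · simp
    · simp only [Nat.add_sub_cancel, pow_succ]; field_simp
  have h := h1.mul h2
  rw [h3] at h
  refine HasDerivAt.congr_deriv (f := profileWeight (n + 1)) h ?_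
  simp only [profileDrift, profileWeight, Nat.add_sub_cancel]
  push_cast
  ring

theorem isProfileSolutionOnPos_of_contDiffOn {N : ℕ} {φ : ℝ → ℝ}
    (h : ContDiffOn ℝ 2 φ (Set.Ioi 0)) (he : SatisfiesProfileEq N φ) :
    IsProfileSolutionOnPos N φ := by
  intro r hr
  have h2 : ContDiffAt ℝ 2 φ r := h.contDiffAt (Ioi_mem_nhds hr)
  refine ⟨(h2.differentiableAt (by norm_num)).hasDerivAt, ?_⟩
  have h3 : DifferentiableAt ℝ (deriv φ) r :=
    (h2.derivWithin (m := 1) (by norm_num)).differentiableAt (by norm_num)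
  refine h3.hasDerivAt.congr_deriv ?_
  have := he r hr
  unfold profileDrift
  linarith

theorem IsRegularSolution.isProfileSolutionOnPos {N : ℕ} {φ : ℝ → ℝ}
    (h : IsRegularSolution N φ) : IsProfileSolutionOnPos N φ :=
  isProfileSolutionOnPos_of_contDiffOn (h.contDiffOn.mono Set.Ioi_subset_Ici_self)
    h.satisfiesProfileEq

theorem IsSingularSolution.isProfileSolutionOnPos {N : ℕ} {φ : ℝ → ℝ}
    (h : IsSingularSolution N φ) : IsProfileSolutionOnPos N φ :=
  isProfileSolutionOnPos_of_contDiffOn h.contDiffOn h.satisfiesProfileEq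

theorem IsRegularSolution.tendsto_zero {N : ℕ} {φ : ℝ → ℝ} (h : IsRegularSolution N φ) :
    Tendsto φ (𝓝[>] 0) (𝓝 (φ 0)) :=
  (h.contDiffOn.continuousOn 0 Set.self_mem_Ici).mono_left
    (nhdsWithin_mono _ Set.Ioi_subset_Ici_self)

theorem IsRegularSolution.tendsto_deriv_zero {N : ℕ} {φ : ℝ → ℝ} (h : IsRegularSolution N φ) :
    Tendsto (deriv φ) (𝓝[>] 0) (𝓝 0) := by
  have h1 := h.contDiffOn.continuousOn_derivWithin (uniqueDiffOn_Ici 0) (by norm_num)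
  have h2 := (h1 0 Set.self_mem_Ici).mono_left (nhdsWithin_mono _ Set.Ioi_subset_Ici_self)
  -- `φ` is arbitrary on negative reals, so only the one-sided derivative at `0` is controlled; it
  -- agrees with `deriv φ` for `r > 0`.
  rw [h.hasDerivWithinAt_zero.derivWithin (uniqueDiffOn_Ici 0 0 Set.self_mem_Ici)] at h2
  refine h2.congr' ?_
  filter_upwards [self_mem_nhdsWithin] with r hr
  exact derivWithin_of_mem_nhds (Ici_mem_nhds hr)

theorem tendsto_diffWronskian_zero {N : ℕ} {φ₁ φ₂ φ₃ : ℝ → ℝ} (h₁ : IsRegularSolution N φ₁)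
    (h₂ : IsRegularSolution N φ₂) (h₃ : IsRegularSolution N φ₃) :
    Tendsto (diffWronskian N φ₁ φ₂ φ₃) (𝓝[>] 0) (𝓝 0) := by
  have hρ : Tendsto (profileWeight N) (𝓝[>] 0) (𝓝 (profileWeight N 0)) :=
    (continuous_profileWeight N).continuousAt.tendsto.mono_left nhdsWithin_le_nhds
  have := hρ.mul (((h₂.tendsto_deriv_zero.sub h₁.tendsto_deriv_zero).mul
    (h₃.tendsto_zero.sub h₂.tendsto_zero)).sub ((h₂.tendsto_zero.sub h₁.tendsto_zero).mul
    (h₃.tendsto_deriv_zero.sub h₂.tendsto_deriv_zero)))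
  simp only [sub_self, zero_mul, mul_zero] at this
  exact this

/-! ### Convexity of `exp` and monotonicity of the Wronskian. -/

/-- The tangent-line inequality for the exponential function. -/
theorem exp_mul_sub_le (x y : ℝ) : Real.exp x * (y - x) ≤ Real.exp y - Real.exp x := by
  have h := Real.add_one_le_exp (y - x)
  have h2 : Real.exp y = Real.exp x * Real.exp (y - x) := by rw [← Real.exp_add]; ring_nf
  nlinarith [Real.exp_pos x]

theorem exp_mul_sub_lt {x y : ℝ} (hxy : x ≠ y) :
    Real.exp x * (y - x) < Real.exp y - Real.exp x := by
  have h := Real.add_one_lt_exp (sub_ne_zero.2 hxy.symm)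
  have h2 : Real.exp y = Real.exp x * Real.exp (y - x) := by rw [← Real.exp_add]; ring_nf
  nlinarith [Real.exp_pos x]

theorem hasDerivAt_diffWronskian {N : ℕ} (hN : 1 ≤ N) {φ₁ φ₂ φ₃ : ℝ → ℝ}
    (h₁ : IsProfileSolutionOnPos N φ₁) (h₂ : IsProfileSolutionOnPos N φ₂)
    (h₃ : IsProfileSolutionOnPos N φ₃) {r : ℝ} (hr : 0 < r) :
    HasDerivAt (diffWronskian N φ₁ φ₂ φ₃)
      (profileWeight N r * ((φ₂ r - φ₁ r) * (Real.exp (φ₃ r) - Real.exp (φ₂ r)) -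
        (Real.exp (φ₂ r) - Real.exp (φ₁ r)) * (φ₃ r - φ₂ r))) r := by
  obtain ⟨a1, b1⟩ := h₁ r hr
  obtain ⟨a2, b2⟩ := h₂ r hr
  obtain ⟨a3, b3⟩ := h₃ r hr
  have h := (hasDerivAt_profileWeight hN hr).mul
    (((b2.sub b1).mul (a3.sub a2)).sub ((a2.sub a1).mul (b3.sub b2)))
  refine HasDerivAt.congr_deriv (f := diffWronskian N φ₁ φ₂ φ₃) h ?_
  simp only [Pi.sub_apply, Pi.mul_apply]
  ring

/-- The derivative is `ρ w v` times the difference of two adjacent chord slopes of `exp`. Order is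
required only in the interior, so the differences may vanish at endpoints. -/
theorem strictMonoOn_diffWronskian {N : ℕ} (hN : 1 ≤ N) {φ₁ φ₂ φ₃ : ℝ → ℝ}
    (h₁ : IsProfileSolutionOnPos N φ₁) (h₂ : IsProfileSolutionOnPos N φ₂)
    (h₃ : IsProfileSolutionOnPos N φ₃) {s : Set ℝ} (hs : Convex ℝ s) (hpos : ∀ r ∈ s, 0 < r)
    (h12 : ∀ r ∈ interior s, φ₁ r < φ₂ r) (h23 : ∀ r ∈ interior s, φ₂ r < φ₃ r) :
    StrictMonoOn (diffWronskian N φ₁ φ₂ φ₃) s := by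
  have hd := fun r (hr : r ∈ s) => hasDerivAt_diffWronskian hN h₁ h₂ h₃ (hpos r hr)
  refine strictMonoOn_of_deriv_pos hs (fun r hr => (hd r hr).continuousAt.continuousWithinAt) ?_
  intro r hr
  rw [(hd r (interior_subset hr)).deriv]
  have hw := sub_pos.2 (h12 r hr)
  have hv := sub_pos.2 (h23 r hr)
  refine mul_pos (profileWeight_pos N (hpos r (interior_subset hr))) ?_
  have e1 := mul_lt_mul_of_pos_left (exp_mul_sub_lt (h23 r hr).ne) hw
  have e2 := mul_le_mul_of_nonneg_right (exp_mul_sub_le (φ₂ r) (φ₁ r)) hv.le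
  linarith

/-! ### Uniqueness at a touching point. -/

/-- Ordered solutions that touch at a positive radius coincide. -/
theorem IsProfileSolutionOnPos.eqOn_of_touch {N : ℕ} {φ₁ φ₂ : ℝ → ℝ}
    (h₁ : IsProfileSolutionOnPos N φ₁) (h₂ : IsProfileSolutionOnPos N φ₂)
    (hle : ∀ r : ℝ, 0 < r → φ₁ r ≤ φ₂ r) {r₀ : ℝ} (hr₀ : 0 < r₀) (heq : φ₁ r₀ = φ₂ r₀) :
    ∀ r : ℝ, 0 < r → φ₁ r = φ₂ r := by
  intro r hr
  set w : ℝ → ℝ := fun x => φ₂ x - φ₁ x with hw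
  set z : ℝ → ℝ := fun x => deriv φ₂ x - deriv φ₁ x with hz
  have hwd : ∀ x, 0 < x → HasDerivAt w (z x) x := fun x hx => (h₂ x hx).1.sub (h₁ x hx).1
  have hzd : ∀ x, 0 < x → HasDerivAt z (-(profileDrift N x * z x) -
      (Real.exp (φ₂ x) - Real.exp (φ₁ x))) x := fun x hx =>
    ((h₂ x hx).2.sub (h₁ x hx).2).congr_deriv (by simp only [hz]; ring)
  have hz0 : z r₀ = 0 := by
    -- Touching from one side is tangential, so both Cauchy data of the difference vanish at `r₀`.
    have hmin : IsLocalMin w r₀ := by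
      filter_upwards [Ioi_mem_nhds hr₀] with x hx
      have := hle x hx
      simp only [hw, heq]; linarith
    exact hmin.hasDerivAt_eq_zero (hwd r₀ hr₀)
  have hw0 : w r₀ = 0 := by simp [hw, heq]
  obtain ⟨K, hK0, hK⟩ : ∃ K : ℝ, 0 ≤ K ∧ ∀ x ∈ Set.uIcc r₀ r,
      1 + 2 * |profileDrift N x| + Real.exp (φ₂ x) ≤ K := by
    have hc : ContinuousOn (fun x => 1 + 2 * |profileDrift N x| + Real.exp (φ₂ x))
        (Set.uIcc r₀ r) := by
      have hpos : ∀ x ∈ Set.uIcc r₀ r, 0 < x := fun x hx => lt_of_lt_of_le (lt_min hr₀ hr) hx.1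
      have h2c : ContinuousOn φ₂ (Set.uIcc r₀ r) := fun x hx =>
        (h₂ x (hpos x hx)).1.continuousAt.continuousWithinAt
      have hdc : ContinuousOn (profileDrift N) (Set.uIcc r₀ r) := by
        unfold profileDrift
        exact (continuousOn_const.div continuousOn_id fun x hx => (hpos x hx).ne').add
          (continuousOn_id.div_const 2)
      exact (continuousOn_const.add (continuousOn_const.mul hdc.abs)).add h2c.rexp
    obtain ⟨K, hK⟩ := isCompact_uIcc.exists_bound_of_continuousOn hc
    exact ⟨K, (norm_nonneg _).trans (hK r₀ Set.left_mem_uIcc),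
      fun x hx => (le_abs_self _).trans (hK x hx)⟩
  -- Gronwall argument: `|E'| ≤ K E` and `E r₀ = 0` force `E = 0`, using the factor `exp (-K x)` to
  -- the right of `r₀` and `exp (K x)` to the left.
  set E : ℝ → ℝ := fun x => w x ^ 2 + z x ^ 2 with hE
  set E' : ℝ → ℝ := fun x => 2 * w x * z x + 2 * z x * (-(profileDrift N x * z x) -
      (Real.exp (φ₂ x) - Real.exp (φ₁ x))) with hE'
  have hEd : ∀ x, 0 < x → HasDerivAt E (E' x) x := fun x hx =>
    (((hwd x hx).pow 2).add ((hzd x hx).pow 2)).congr_deriv (by simp only [hE']; push_cast; ring)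
  have hpos : ∀ x ∈ Set.uIcc r₀ r, 0 < x := fun x hx => lt_of_lt_of_le (lt_min hr₀ hr) hx.1
  have hbound : ∀ x ∈ Set.uIcc r₀ r, |E' x| ≤ K * E x := by
    intro x hx
    have hwx : 0 ≤ w x := sub_nonneg.2 (hle x (hpos x hx))
    have hf : |Real.exp (φ₂ x) - Real.exp (φ₁ x)| ≤ Real.exp (φ₂ x) * w x := by
      rw [abs_of_nonneg (sub_nonneg.2 (Real.exp_le_exp.2 (hle x (hpos x hx))))]
      have := exp_mul_sub_le (φ₂ x) (φ₁ x)
      simp only [hw]; linarith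
    have h1 : |E' x| ≤ 2 * w x * |z x| + 2 * |profileDrift N x| * |z x| ^ 2 +
        2 * |z x| * (Real.exp (φ₂ x) * w x) := by
      have e : E' x = 2 * w x * z x + (-(2 * profileDrift N x * z x ^ 2)) +
        (-(2 * z x * (Real.exp (φ₂ x) - Real.exp (φ₁ x)))) := by simp only [hE']; ring
      rw [e]
      refine (abs_add_three _ _ _).trans ?_
      simp only [abs_neg, abs_mul, abs_pow, abs_two, abs_of_nonneg hwx]
      gcongr
    have h2 : 2 * w x * |z x| ≤ E x := by
      have := two_mul_le_add_sq (w x) |z x|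
      rw [sq_abs] at this; exact this
    have h3 : |z x| ^ 2 ≤ E x := by rw [sq_abs]; simp only [hE]; nlinarith [sq_nonneg (w x)]
    calc |E' x| ≤ _ := h1
      _ = 2 * w x * |z x| + 2 * |profileDrift N x| * |z x| ^ 2 +
        Real.exp (φ₂ x) * (2 * w x * |z x|) := by ring
      _ ≤ E x + 2 * |profileDrift N x| * E x + Real.exp (φ₂ x) * E x := by gcongr
      _ = (1 + 2 * |profileDrift N x| + Real.exp (φ₂ x)) * E x := by ring
      _ ≤ K * E x := by
        gcongr
        exact hK x hx
  have hE0 : E r₀ = 0 := by simp [hE, hw0, hz0]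
  have hGd : ∀ k x, 0 < x → HasDerivAt (fun y => E y * Real.exp (k * y))
      ((E' x + k * E x) * Real.exp (k * x)) x := fun k x hx =>
    ((hEd x hx).mul (((hasDerivAt_id x).const_mul k).exp)).congr_deriv (by simp; ring)
  have hEr : E r ≤ 0 := by
    rcases le_total r₀ r with hle' | hle'
    · rw [Set.uIcc_of_le hle'] at hbound hpos
      have := antitoneOn_of_deriv_nonpos (convex_Icc r₀ r)
        (f := fun y => E y * Real.exp (-K * y))
        (fun x hx => (hGd (-K) x (hpos x hx)).continuousAt.continuousWithinAt)
        (fun x hx => (hGd (-K) x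
          (hpos x (interior_subset hx))).differentiableAt.differentiableWithinAt)
        (fun x hx => by
          rw [(hGd (-K) x (hpos x (interior_subset hx))).deriv]
          have := (abs_le.1 (hbound x (interior_subset hx))).2
          exact mul_nonpos_of_nonpos_of_nonneg (by linarith) (Real.exp_pos _).le)
        (Set.left_mem_Icc.2 hle') (Set.right_mem_Icc.2 hle') hle'
      simp only [hE0, zero_mul] at this
      exact nonpos_of_mul_nonpos_left this (Real.exp_pos _)
    · rw [Set.uIcc_of_ge hle'] at hbound hpos
      have := monotoneOn_of_deriv_nonneg (convex_Icc r r₀)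
        (f := fun y => E y * Real.exp (K * y))
        (fun x hx => (hGd K x (hpos x hx)).continuousAt.continuousWithinAt)
        (fun x hx => (hGd K x
          (hpos x (interior_subset hx))).differentiableAt.differentiableWithinAt)
        (fun x hx => by
          rw [(hGd K x (hpos x (interior_subset hx))).deriv]
          have := (abs_le.1 (hbound x (interior_subset hx))).1
          exact mul_nonneg (by linarith) (Real.exp_pos _).le)
        (Set.left_mem_Icc.2 hle') (Set.right_mem_Icc.2 hle') hle'
      simp only [hE0, zero_mul] at this
      exact nonpos_of_mul_nonpos_left this (Real.exp_pos _)
  have : w r = 0 := by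
    simp only [hE] at hEr
    nlinarith [sq_nonneg (w r), sq_nonneg (z r)]
  simp only [hw] at this
  linarith

/-! ### Decay at infinity of the difference of two solutions. -/

theorem hasDerivAt_exp_div_sq (k : ℝ) {r : ℝ} (hr : 0 < r) :
    HasDerivAt (fun x : ℝ => Real.exp (k / x ^ 2)) (-(2 * k / r ^ 3) * Real.exp (k / r ^ 2)) r := by
  have h := ((hasDerivAt_const r k).div (hasDerivAt_pow 2 r) (by positivity)).exp
  refine HasDerivAt.congr_deriv h ?_
  rw [mul_comm]
  simp only [Pi.div_apply]
  congr 1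
  field_simp
  ring

/-- A positive solution of `w'' + (drift) w' + f = 0`, `f ≤ C w / r²`, tending to `0` at infinity
decays fast. -/
theorem deriv_le_neg_mul_of_tendsto_zero {N : ℕ} (hN : 1 ≤ N) {w z f : ℝ → ℝ} {R₀ C : ℝ}
    (hR₀ : 0 ≤ R₀) (hC : 0 ≤ C) (hw : ∀ r, R₀ < r → HasDerivAt w (z r) r)
    (hz : ∀ r, R₀ < r → HasDerivAt z (-(profileDrift N r * z r) - f r) r)
    (hpos : ∀ r, R₀ < r → 0 < w r) (hf : ∀ r, R₀ < r → f r ≤ C / r ^ 2 * w r)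
    (hlim : Tendsto w atTop (𝓝 0)) {r₁ : ℝ} (hr₁ : R₀ + 24 + 32 * C ≤ r₁) :
    z r₁ ≤ -(r₁ / 4) * w r₁ := by
  by_contra! hcon
  have hr1R : R₀ < r₁ := by linarith
  have hr1pos : 0 < r₁ := by linarith
  -- Chosen so that `κ / r ^ 3` equals `r / 4` at `r₁` and stays below it afterwards, while being
  -- integrable at infinity. If `h = z + (κ / r ^ 3) w` stays positive, then `w * exp (-κ / (2 r ^
  -- 2))` increases and `w` cannot tend to `0`.
  set κ : ℝ := r₁ ^ 4 / 4 with hκ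
  have hκ8 : 8 * C ≤ κ := by
    have h1 : 1 ≤ r₁ ^ 3 := one_le_pow₀ (by linarith)
    have h2 : r₁ ^ 4 = r₁ ^ 3 * r₁ := by ring
    have h3 : r₁ ≤ r₁ ^ 4 := by rw [h2]; nlinarith
    linarith
  have hκpos : 0 < κ := by positivity
  set h : ℝ → ℝ := fun r => z r + κ / r ^ 3 * w r with hh
  have hd : ∀ r, R₀ < r → HasDerivAt h (-(profileDrift N r * z r) - f r +
      (-(3 * κ / r ^ 4) * w r + κ / r ^ 3 * z r)) r := by
    intro r hr
    have hr0 : 0 < r := by linarith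
    have h1 : HasDerivAt (fun x : ℝ => κ / x ^ 3) (-(3 * κ / r ^ 4)) r :=
      HasDerivAt.congr_deriv ((hasDerivAt_const r κ).div (hasDerivAt_pow 3 r) (by positivity))
        (by field_simp; ring)
    exact (hz r hr).add (h1.mul (hw r hr))
  have hHd : ∀ r, R₀ < r → HasDerivAt
      (fun x => h x * (profileWeight N x * Real.exp ((κ / 2) / x ^ 2)))
      (profileWeight N r * Real.exp ((κ / 2) / r ^ 2) *
        (((profileDrift N r - κ / r ^ 3) * (κ / r ^ 3) - 3 * κ / r ^ 4) * w r - f r)) r := by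
    intro r hr
    have hr0 : 0 < r := by linarith
    refine HasDerivAt.congr_deriv ((hd r hr).mul ((hasDerivAt_profileWeight hN hr0).mul
      (hasDerivAt_exp_div_sq (κ / 2) hr0))) ?_
    simp only [hh]
    ring
  have hbr : ∀ r, r₁ ≤ r →
      0 ≤ ((profileDrift N r - κ / r ^ 3) * (κ / r ^ 3) - 3 * κ / r ^ 4) * w r - f r := by
    intro r hr
    have hr0 : 0 < r := by linarith
    have hN' : (1 : ℝ) ≤ N := by exact_mod_cast hN
    have hθ : κ / r ^ 3 ≤ r / 4 := by
      rw [div_le_iff₀ (by positivity), hκ]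
      have : r₁ ^ 4 ≤ r ^ 4 := by gcongr
      nlinarith
    have hD : r / 4 ≤ profileDrift N r - κ / r ^ 3 := by
      have : 0 ≤ ((N : ℝ) - 1) / r := div_nonneg (by linarith) hr0.le
      unfold profileDrift; linarith
    have h1 : r / 4 * (κ / r ^ 3) ≤ (profileDrift N r - κ / r ^ 3) * (κ / r ^ 3) := by gcongr
    have h2 : C / r ^ 2 ≤ r / 4 * (κ / r ^ 3) - 3 * κ / r ^ 4 := by
      have e : r / 4 * (κ / r ^ 3) - 3 * κ / r ^ 4 - C / r ^ 2 =
          (κ * (r ^ 2 / 4 - 3) - C * r ^ 2) / r ^ 4 := by field_simp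
      have : 0 ≤ (κ * (r ^ 2 / 4 - 3) - C * r ^ 2) / r ^ 4 := by
        apply div_nonneg _ (by positivity)
        -- This gives `r ^ 2 / 4 - 3 ≥ r ^ 2 / 8`, and `κ ≥ 8 C` then absorbs `C r ^ 2`.
        have hr24 : 24 ≤ r ^ 2 := by nlinarith
        nlinarith [mul_nonneg hκpos.le (sub_nonneg.2 hr24),
          mul_nonneg (sub_nonneg.2 hκ8) (sq_nonneg r)]
      linarith
    have h3 := hf r (by linarith)
    have h4 := mul_le_mul_of_nonneg_right (h2.trans (sub_le_sub_right h1 _))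
      (hpos r (by linarith)).le
    linarith
  have hRI : ∀ r ∈ Set.Ici r₁, R₀ < r := fun r hr => hr1R.trans_le hr
  have hHm : MonotoneOn (fun x => h x * (profileWeight N x * Real.exp ((κ / 2) / x ^ 2)))
      (Set.Ici r₁) := by
    refine monotoneOn_of_deriv_nonneg (convex_Ici r₁)
      (fun r hr => (hHd r (hRI r hr)).continuousAt.continuousWithinAt)
      (fun r hr => (hHd r
        (hRI r (interior_subset hr))).differentiableAt.differentiableWithinAt) ?_
    intro r hr
    have hr' := interior_subset hr
    rw [(hHd r (hRI r hr')).deriv]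
    exact mul_nonneg (mul_pos (profileWeight_pos N (hR₀.trans_lt (hRI r hr')))
      (Real.exp_pos _)).le (hbr r hr')
  have hr1h : 0 < h r₁ := by
    have : κ / r₁ ^ 3 = r₁ / 4 := by rw [hκ]; field_simp
    simp only [hh, this]; linarith
  have hhpos : ∀ r ∈ Set.Ici r₁, 0 < h r := by
    intro r hr
    have := hHm Set.self_mem_Ici hr hr
    have hp : ∀ x ∈ Set.Ici r₁, 0 < profileWeight N x * Real.exp ((κ / 2) / x ^ 2) := fun x hx =>
      mul_pos (profileWeight_pos N (hR₀.trans_lt (hRI x hx))) (Real.exp_pos _)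
    exact pos_of_mul_pos_left ((mul_pos hr1h (hp r₁ Set.self_mem_Ici)).trans_le this) (hp r hr).le
  have hGd : ∀ r, R₀ < r → HasDerivAt (fun x => w x * Real.exp ((-κ / 2) / x ^ 2))
      (Real.exp ((-κ / 2) / r ^ 2) * h r) r := by
    intro r hr
    refine HasDerivAt.congr_deriv
      ((hw r hr).mul (hasDerivAt_exp_div_sq (-κ / 2) (hR₀.trans_lt hr))) ?_
    simp only [hh]
    ring
  have hGm : MonotoneOn (fun x => w x * Real.exp ((-κ / 2) / x ^ 2)) (Set.Ici r₁) := by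
    refine monotoneOn_of_deriv_nonneg (convex_Ici r₁)
      (fun r hr => (hGd r (hRI r hr)).continuousAt.continuousWithinAt)
      (fun r hr => (hGd r
        (hRI r (interior_subset hr))).differentiableAt.differentiableWithinAt) ?_
    intro r hr
    have hr' := interior_subset hr
    rw [(hGd r (hRI r hr')).deriv]
    exact mul_nonneg (Real.exp_pos _).le (hhpos r hr').le
  have hlow : ∀ r ∈ Set.Ici r₁, w r₁ * Real.exp ((-κ / 2) / r₁ ^ 2) ≤ w r := by
    intro r hr
    refine (hGm Set.self_mem_Ici hr hr).trans (mul_le_of_le_one_right (hpos r (hRI r hr)).le ?_)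
    rw [Real.exp_le_one_iff]
    exact div_nonpos_of_nonpos_of_nonneg (by linarith) (sq_nonneg r)
  have := ge_of_tendsto hlim ((eventually_ge_atTop r₁).mono hlow)
  exact absurd this (not_le.2 (mul_pos (hpos r₁ hr1R) (Real.exp_pos _)))

/-- Since `(ρ z)' = -ρ f` and `f ≤ C w / r ^ 2 ≤ -(4 C / r ^ 3) z`, the bounded factor `exp (2 C / r
^ 2)` makes `-ρ z` nonincreasing. For `r ≥ 4` the decay estimate gives `w ≤ -z`, so `ρ w` is bounded
too. -/
theorem exists_weight_mul_le {N : ℕ} (hN : 1 ≤ N) {w z f : ℝ → ℝ} {R₀ C : ℝ}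
    (hR₀ : 0 ≤ R₀) (hC : 0 ≤ C) (hw : ∀ r, R₀ < r → HasDerivAt w (z r) r)
    (hz : ∀ r, R₀ < r → HasDerivAt z (-(profileDrift N r * z r) - f r) r)
    (hpos : ∀ r, R₀ < r → 0 < w r) (hf : ∀ r, R₀ < r → f r ≤ C / r ^ 2 * w r)
    (hlim : Tendsto w atTop (𝓝 0)) :
    ∃ R P : ℝ, R₀ < R ∧ 1 ≤ R ∧ 0 < P ∧
      ∀ r, R ≤ r → z r ≤ 0 ∧ profileWeight N r * w r ≤ P := by
  set R : ℝ := R₀ + 24 + 32 * C with hR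
  have hdec : ∀ r, R ≤ r → z r ≤ -(r / 4) * w r := fun r hr =>
    deriv_le_neg_mul_of_tendsto_zero hN hR₀ hC hw hz hpos hf hlim hr
  have hRI : ∀ r, R ≤ r → R₀ < r := fun r hr => by linarith
  have hQd : ∀ r, R₀ < r → HasDerivAt
      (fun x => -(profileWeight N x * z x) * Real.exp ((2 * C) / x ^ 2))
      (profileWeight N r * Real.exp ((2 * C) / r ^ 2) * (f r + 4 * C / r ^ 3 * z r)) r := by
    intro r hr
    have hr0 := hR₀.trans_lt hr
    refine HasDerivAt.congr_deriv (((hasDerivAt_profileWeight hN hr0).mul (hz r hr)).neg.mul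
      (hasDerivAt_exp_div_sq (2 * C) hr0)) ?_
    simp only [Pi.mul_apply, Pi.neg_apply]
    ring
  have hQm : AntitoneOn (fun x => -(profileWeight N x * z x) * Real.exp ((2 * C) / x ^ 2))
      (Set.Ici R) := by
    refine antitoneOn_of_deriv_nonpos (convex_Ici R)
      (fun r hr => (hQd r (hRI r hr)).continuousAt.continuousWithinAt)
      (fun r hr => (hQd r
        (hRI r (interior_subset hr))).differentiableAt.differentiableWithinAt) ?_
    intro r hr
    have hr' : R ≤ r := interior_subset hr
    have hr0 := hR₀.trans_lt (hRI r hr')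
    rw [(hQd r (hRI r hr')).deriv]
    refine mul_nonpos_of_nonneg_of_nonpos
      (mul_pos (profileWeight_pos N hr0) (Real.exp_pos _)).le ?_
    have h1 := hf r (hRI r hr')
    have h2 := mul_le_mul_of_nonneg_left (hdec r hr') (a := 4 * C / r ^ 3) (by positivity)
    have h3 : 4 * C / r ^ 3 * (-(r / 4) * w r) = -(C / r ^ 2 * w r) := by field_simp
    linarith
  set P : ℝ := -(profileWeight N R * z R) * Real.exp ((2 * C) / R ^ 2) with hP
  have hz0 : ∀ r, R ≤ r → w r ≤ -z r ∧ 0 < -z r := by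
    intro r hr
    have h1 := hdec r hr
    have h2 := hpos r (hRI r hr)
    constructor <;> nlinarith
  have hPpos : 0 < P := by
    have h1 := (hz0 R le_rfl).2
    have h2 := profileWeight_pos N (hR₀.trans_lt (hRI R le_rfl))
    rw [hP, ← mul_neg]
    positivity
  refine ⟨R, P, hRI R le_rfl, by linarith, hPpos, fun r hr => ⟨by linarith [(hz0 r hr).2], ?_⟩⟩
  have hρ := profileWeight_pos N (hR₀.trans_lt (hRI r hr))
  have h1 : -(profileWeight N r * z r) * Real.exp ((2 * C) / r ^ 2) ≤ P :=
    hQm Set.self_mem_Ici hr hr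
  have h2 : 1 ≤ Real.exp ((2 * C) / r ^ 2) := Real.one_le_exp (by positivity)
  have h3 : 0 ≤ -(profileWeight N r * z r) := by
    rw [← mul_neg]; exact (mul_pos hρ (hz0 r hr).2).le
  have h4 := mul_le_mul_of_nonneg_left (hz0 r hr).1 hρ.le
  have h5 := le_mul_of_one_le_right h3 h2
  linarith

/-! ### Sign of the Wronskian forced by behaviour at infinity. -/

/-- The Wronskian of an eventually ordered triple is negative when the lower two solutions are
asymptotic to each other. -/
theorem diffWronskian_neg {N : ℕ} (hN : 1 ≤ N) {φ₁ φ₂ φ₃ : ℝ → ℝ} {L r₀ : ℝ}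
    (h₁ : IsProfileSolutionOnPos N φ₁) (h₂ : IsProfileSolutionOnPos N φ₂)
    (h₃ : IsProfileSolutionOnPos N φ₃) (hr₀ : 0 < r₀)
    (h12 : ∀ r, r₀ ≤ r → φ₁ r < φ₂ r) (h23 : ∀ r, r₀ ≤ r → φ₂ r < φ₃ r)
    (hL₁ : Tendsto (fun r : ℝ => 2 * Real.log r + φ₁ r) atTop (𝓝 L))
    (hL₂ : Tendsto (fun r : ℝ => 2 * Real.log r + φ₂ r) atTop (𝓝 L)) :
    diffWronskian N φ₁ φ₂ φ₃ r₀ < 0 := by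
  by_contra! hW
  have hlim : Tendsto (fun r => φ₂ r - φ₁ r) atTop (𝓝 0) := by
    have := hL₂.sub hL₁
    simpa using this
  obtain ⟨A, hA⟩ := eventually_atTop.1 (hL₂.eventually_le_const (lt_add_one L))
  -- Beyond `A` the asymptotics give `exp (φ₂ r) ≤ exp (L + 1) / r ^ 2`, the potential bound needed
  -- for decay.
  set R₀ := max r₀ A with hR₀
  have hr₀R : r₀ ≤ R₀ := le_max_left _ _
  obtain ⟨R, P, hR, hR1, hP, hdec⟩ := exists_weight_mul_le hN (w := fun r => φ₂ r - φ₁ r)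
    (z := fun r => deriv φ₂ r - deriv φ₁ r) (f := fun r => Real.exp (φ₂ r) - Real.exp (φ₁ r))
    (R₀ := R₀) (C := Real.exp (L + 1)) (hr₀.le.trans hr₀R) (Real.exp_pos _).le
    (fun r hr => (h₂ r (by linarith)).1.sub (h₁ r (by linarith)).1)
    (fun r hr => ((h₂ r (by linarith)).2.sub (h₁ r (by linarith)).2).congr_deriv (by ring))
    (fun r hr => sub_pos.2 (h12 r (by linarith)))
    (fun r hr => by
      have hr0 : 0 < r := by linarith
      have hw := sub_pos.2 (h12 r (by linarith))
      have h1 : Real.exp (φ₂ r) ≤ Real.exp (L + 1) / r ^ 2 := by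
        have h2 := Real.exp_le_exp.2 (hA r ((le_max_right r₀ A).trans hr.le))
        have h3 : Real.exp (2 * Real.log r + φ₂ r) = r ^ 2 * Real.exp (φ₂ r) := by
          rw [Real.exp_add, two_mul, Real.exp_add, Real.exp_log hr0]; ring
        rw [le_div_iff₀ (by positivity)]
        linarith
      have h4 := exp_mul_sub_le (φ₂ r) (φ₁ r)
      have h5 := mul_le_mul_of_nonneg_right h1 hw.le
      linarith) hlim
  have hmono : StrictMonoOn (diffWronskian N φ₁ φ₂ φ₃) (Set.Ici r₀) :=
    strictMonoOn_diffWronskian hN h₁ h₂ h₃ (convex_Ici r₀) (fun r hr => hr₀.trans_le hr)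
      (fun r hr => h12 r (interior_subset hr)) (fun r hr => h23 r (interior_subset hr))
  have hr₀lt : r₀ < R := by linarith
  set δ := diffWronskian N φ₁ φ₂ φ₃ R with hδ
  have hδpos : 0 < δ := hW.trans_lt (hmono Set.self_mem_Ici hr₀lt.le hr₀lt)
  -- As `w' ≤ 0`, `W ≥ δ` leaves `-ρ w v' ≥ δ`; with `ρ w ≤ P` the slope of `v` is at most `-δ / P`.
  have hv' : ∀ r, R ≤ r → deriv φ₃ r - deriv φ₂ r + δ / P ≤ 0 := by
    intro r hr
    have hr0 : r₀ ≤ r := by linarith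
    obtain ⟨hz, hwP⟩ := hdec r hr
    have hρ := profileWeight_pos N (hr₀.trans_le hr0)
    have hw := sub_pos.2 (h12 r hr0)
    have hv := sub_pos.2 (h23 r hr0)
    have h1 : δ ≤ diffWronskian N φ₁ φ₂ φ₃ r := hmono.monotoneOn hr₀lt.le hr0 hr
    have h2 : δ ≤ profileWeight N r * (φ₂ r - φ₁ r) * -(deriv φ₃ r - deriv φ₂ r) := by
      unfold diffWronskian at h1
      have := mul_nonpos_of_nonneg_of_nonpos hρ.le (mul_nonpos_of_nonpos_of_nonneg hz hv.le)
      linarith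
    have h3 : 0 < -(deriv φ₃ r - deriv φ₂ r) :=
      pos_of_mul_pos_right (hδpos.trans_le h2) (mul_pos hρ hw).le
    have h4 := h2.trans (mul_le_mul_of_nonneg_right hwP h3.le)
    have h5 : δ / P ≤ -(deriv φ₃ r - deriv φ₂ r) := by
      rw [div_le_iff₀ hP]; linarith
    linarith
  have hd : ∀ r, R ≤ r → HasDerivAt (fun x => φ₃ x - φ₂ x + δ / P * x)
      (deriv φ₃ r - deriv φ₂ r + δ / P) r := fun r hr =>
    (((h₃ r (by linarith)).1.sub (h₂ r (by linarith)).1).add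
      ((hasDerivAt_id r).const_mul (δ / P))).congr_deriv (by simp)
  have hanti : AntitoneOn (fun x => φ₃ x - φ₂ x + δ / P * x) (Set.Ici R) := by
    refine antitoneOn_of_deriv_nonpos (convex_Ici R)
      (fun r hr => (hd r hr).continuousAt.continuousWithinAt)
      (fun r hr => (hd r (interior_subset hr)).differentiableAt.differentiableWithinAt) ?_
    intro r hr
    rw [(hd r (interior_subset hr)).deriv]
    exact hv' r (interior_subset hr)
  have hvR := sub_pos.2 (h23 R hr₀lt.le)
  have hδP : 0 < δ / P := div_pos hδpos hP
  -- The radius by which slope `-δ / P` has used up the gap at `R`.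
  have hle : R ≤ R + (φ₃ R - φ₂ R) / (δ / P) := by
    have := div_pos hvR hδP; linarith
  have h1 := hanti Set.self_mem_Ici hle hle
  have h2 := sub_pos.2 (h23 _ (hr₀lt.le.trans hle))
  have h3 : δ / P * (R + (φ₃ R - φ₂ R) / (δ / P)) = δ / P * R + (φ₃ R - φ₂ R) := by
    rw [mul_add, mul_div_cancel₀ _ hδP.ne']
  simp only at h1
  linarith

/-! ### Comparison when the lower difference may change sign. -/

theorem exists_last_zero {f : ℝ → ℝ} {a b : ℝ} (hab : a ≤ b) (hf : ContinuousOn f (Set.Icc a b))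
    (ha : f a ≤ 0) (hb : 0 < f b) :
    ∃ c ∈ Set.Ico a b, f c = 0 ∧ ∀ x ∈ Set.Ioc c b, 0 < f x := by
  have hcl : IsClosed (Set.Icc a b ∩ f ⁻¹' Set.Iic 0) :=
    hf.preimage_isClosed_of_isClosed isClosed_Icc isClosed_Iic
  obtain ⟨c, ⟨hc, hfc⟩, hmax⟩ := (isCompact_Icc.of_isClosed_subset hcl
    Set.inter_subset_left).exists_isGreatest ⟨a, Set.left_mem_Icc.2 hab, ha⟩
  have hcb : c < b := lt_of_le_of_ne hc.2 (by rintro rfl; exact not_lt.2 hfc hb)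
  have hpos : ∀ x ∈ Set.Ioc c b, 0 < f x := fun x hx => by
    by_contra! h
    exact not_le.2 hx.1 (hmax ⟨⟨hc.1.trans hx.1.le, hx.2⟩, h⟩)
  refine ⟨c, ⟨hc.1, hcb⟩, ?_, hpos⟩
  obtain ⟨d, hd, hfd⟩ := intermediate_value_Icc hcb.le (hf.mono (Set.Icc_subset_Icc_left hc.1))
    ⟨hfc, hb.le⟩
  rcases hd.1.eq_or_lt with rfl | h
  · exact hfd
  · exact absurd hfd (hpos d ⟨h, hd.2⟩).ne'

theorem exists_first_zero {f : ℝ → ℝ} {a b : ℝ} (hab : a ≤ b) (hf : ContinuousOn f (Set.Icc a b))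
    (ha : 0 < f a) (hb : f b ≤ 0) :
    ∃ c ∈ Set.Ioc a b, f c = 0 ∧ ∀ x ∈ Set.Ico a c, 0 < f x := by
  obtain ⟨c, hc, h0, hpos⟩ := exists_last_zero (f := fun x => f (-x)) (neg_le_neg hab)
    (hf.comp continuous_neg.continuousOn fun x hx => ⟨by linarith [hx.2], by linarith [hx.1]⟩)
    (by simpa using hb) (by simpa using ha)
  refine ⟨-c, ⟨by linarith [hc.2], by linarith [hc.1]⟩, h0, fun x hx => ?_⟩
  simpa using hpos (-x) ⟨by linarith [hx.2], by linarith [hx.1]⟩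

theorem HasDerivAt.nonneg_of_pos_right {f : ℝ → ℝ} {d a b : ℝ} (hf : HasDerivAt f d a)
    (hab : a < b) (ha : f a = 0) (hpos : ∀ x ∈ Set.Ioc a b, 0 < f x) : 0 ≤ d := by
  refine ge_of_tendsto ((hasDerivWithinAt_iff_tendsto_slope' (s := Set.Ioi a) (lt_irrefl a)).1
    hf.hasDerivWithinAt) ?_
  filter_upwards [Ioc_mem_nhdsGT hab] with x hx
  rw [slope_def_field, ha, sub_zero]
  exact div_nonneg (hpos x hx).le (sub_pos.2 hx.1).le

theorem HasDerivAt.nonpos_of_pos_left {f : ℝ → ℝ} {d a b : ℝ} (hf : HasDerivAt f d a)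
    (hba : b < a) (ha : f a = 0) (hpos : ∀ x ∈ Set.Ico b a, 0 < f x) : d ≤ 0 := by
  refine le_of_tendsto ((hasDerivWithinAt_iff_tendsto_slope' (s := Set.Iio a) (lt_irrefl a)).1
    hf.hasDerivWithinAt) ?_
  filter_upwards [Ico_mem_nhdsLT hba] with x hx
  rw [slope_def_field, ha, sub_zero]
  exact div_nonpos_of_nonneg_of_nonpos (hpos x hx).le (sub_neg.2 hx.2).le

/-- Two solutions with the same asymptotic constant, the upper of which lies below a third
solution, are ordered the other way round. -/
theorem le_of_lt_of_tendsto {N : ℕ} (hN : 1 ≤ N) {φ₁ φ₂ φ₃ : ℝ → ℝ} {L : ℝ}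
    (h₁ : IsProfileSolutionOnPos N φ₁) (h₂ : IsProfileSolutionOnPos N φ₂)
    (h₃ : IsProfileSolutionOnPos N φ₃) (h23 : ∀ r, 0 < r → φ₂ r < φ₃ r)
    (hW : Tendsto (diffWronskian N φ₁ φ₂ φ₃) (𝓝[>] 0) (𝓝 0))
    (hL₁ : Tendsto (fun r : ℝ => 2 * Real.log r + φ₁ r) atTop (𝓝 L))
    (hL₂ : Tendsto (fun r : ℝ => 2 * Real.log r + φ₂ r) atTop (𝓝 L)) :
    ∀ r, 0 < r → φ₂ r ≤ φ₁ r := by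
  intro r hr
  by_contra! hlt
  set w : ℝ → ℝ := fun x => φ₂ x - φ₁ x with hw
  have hwd : ∀ x, 0 < x → HasDerivAt w (deriv φ₂ x - deriv φ₁ x) x := fun x hx =>
    (h₂ x hx).1.sub (h₁ x hx).1
  have hwc : ∀ s ⊆ Set.Ioi (0 : ℝ), ContinuousOn w s := fun s hs x hx =>
    (hwd x (hs hx)).continuousAt.continuousWithinAt
  have hwr : 0 < w r := sub_pos.2 hlt
  -- Going left from `r`, either `w > 0` down to the origin, where `W → 0`, or a last zero of `w` is
  -- met, where `w' ≥ 0` gives `W ≥ 0`.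
  have hWr : 0 < diffWronskian N φ₁ φ₂ φ₃ r := by
    by_cases hall : ∀ x ∈ Set.Ioc 0 r, 0 < w x
    · have hm := strictMonoOn_diffWronskian hN h₁ h₂ h₃ (convex_Ioc 0 r) (fun x hx => hx.1)
        (fun x hx => sub_pos.1 (hall x (interior_subset hx)))
        (fun x hx => h23 x (interior_subset hx).1)
      have hr2 : r / 2 ∈ Set.Ioc 0 r := ⟨by linarith, by linarith⟩
      have h0 : 0 ≤ diffWronskian N φ₁ φ₂ φ₃ (r / 2) := by
        refine le_of_tendsto hW ?_
        filter_upwards [Ioc_mem_nhdsGT hr2.1] with x hx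
        exact hm.monotoneOn ⟨hx.1, hx.2.trans hr2.2⟩ hr2 hx.2
      exact h0.trans_lt (hm hr2 ⟨hr, le_rfl⟩ (by linarith))
    · push Not at hall
      obtain ⟨x, hx, hwx⟩ := hall
      obtain ⟨c, hc, hc0, hcpos⟩ := exists_last_zero hx.2
        (hwc _ fun y hy => hx.1.trans_le hy.1) hwx hwr
      have hcp : 0 < c := hx.1.trans_le hc.1
      have hm := strictMonoOn_diffWronskian hN h₁ h₂ h₃ (convex_Icc c r)
        (fun y hy => hcp.trans_le hy.1)
        (fun y hy => by
          rw [interior_Icc] at hy; exact sub_pos.1 (hcpos y ⟨hy.1, hy.2.le⟩))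
        (fun y hy => h23 y (hcp.trans_le (interior_subset hy).1))
      refine lt_of_le_of_lt ?_ (hm (Set.left_mem_Icc.2 hc.2.le) (Set.right_mem_Icc.2 hc.2.le) hc.2)
      have hd := (hwd c hcp).nonneg_of_pos_right hc.2 hc0 hcpos
      have hv := sub_pos.2 (h23 c hcp)
      have hρ := profileWeight_pos N hcp
      simp only [hw] at hc0
      unfold diffWronskian
      rw [hc0, zero_mul, sub_zero]
      positivity
  -- At a first zero of `w` to the right, `w' ≤ 0` would give `W ≤ 0`, against the increase of `W`
  -- from a positive value.
  have hright : ∀ x, r ≤ x → φ₁ x < φ₂ x := by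
    intro x hx
    by_contra! hle
    obtain ⟨c, hc, hc0, hcpos⟩ := exists_first_zero hx
      (hwc _ fun y hy => hr.trans_le hy.1) hwr (sub_nonpos.2 hle)
    have hcp : 0 < c := hr.trans hc.1
    have hm := strictMonoOn_diffWronskian hN h₁ h₂ h₃ (convex_Icc r c)
      (fun y hy => hr.trans_le hy.1)
      (fun y hy => by
        rw [interior_Icc] at hy; exact sub_pos.1 (hcpos y ⟨hy.1.le, hy.2⟩))
      (fun y hy => h23 y (hr.trans_le (interior_subset hy).1))
    have hWc := hWr.trans
      (hm (Set.left_mem_Icc.2 hc.1.le) (Set.right_mem_Icc.2 hc.1.le) hc.1)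
    have hd := (hwd c hcp).nonpos_of_pos_left hc.1 hc0 hcpos
    have hv := sub_pos.2 (h23 c hcp)
    have hρ := profileWeight_pos N hcp
    simp only [hw] at hc0
    unfold diffWronskian at hWc
    rw [hc0, zero_mul, sub_zero] at hWc
    exact absurd hWc (not_lt.2 (mul_nonpos_of_nonneg_of_nonpos hρ.le
      (mul_nonpos_of_nonpos_of_nonneg hd hv.le)))
  exact lt_asymm hWr (diffWronskian_neg hN h₁ h₂ h₃ hr hright
    (fun x hx => h23 x (hr.trans_le hx)) hL₁ hL₂)

/-! ### Consequences for regular and singular solutions. -/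

/-- Regular solutions are determined at the origin by their values at positive radii. -/
theorem IsRegularSolution.zero_eq {N : ℕ} {φ ψ : ℝ → ℝ} (hφ : IsRegularSolution N φ)
    (hψ : IsRegularSolution N ψ) (h : ∀ r : ℝ, 0 < r → φ r = ψ r) : φ 0 = ψ 0 :=
  tendsto_nhds_unique hφ.tendsto_zero (hψ.tendsto_zero.congr' (by
    filter_upwards [self_mem_nhdsWithin] with r hr using (h r hr).symm))

/-- Regular solutions ordered at positive radii are ordered at the origin. -/
theorem IsRegularSolution.zero_le {N : ℕ} {φ ψ : ℝ → ℝ} (hφ : IsRegularSolution N φ)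
    (hψ : IsRegularSolution N ψ) (h : ∀ r : ℝ, 0 < r → φ r ≤ ψ r) : φ 0 ≤ ψ 0 :=
  le_of_tendsto_of_tendsto hφ.tendsto_zero hψ.tendsto_zero (by
    filter_upwards [self_mem_nhdsWithin] with r hr using h r hr)

/-- Common core of (i)-(iii): either the upper pair touches and coincides, or it is strictly ordered
and the comparison applies. No asymptotics of `φ₃` are needed, which (ii) and (iii) exploit. -/
theorem eq_of_le_of_not_le {N : ℕ} (hN : 1 ≤ N) {φ₁ φ₂ φ₃ : ℝ → ℝ} {L : ℝ}
    (h₁ : φ₁ ∈ solutionSet N L) (h₂ : φ₂ ∈ solutionSet N L) (h₃ : IsRegularSolution N φ₃)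
    (h23 : ∀ r : ℝ, 0 < r → φ₂ r ≤ φ₃ r) (h12 : ¬ ∀ r : ℝ, 0 < r → φ₂ r ≤ φ₁ r) :
    ∀ r : ℝ, 0 < r → φ₂ r = φ₃ r := by
  have p₁ := h₁.1.isProfileSolutionOnPos
  have p₂ := h₂.1.isProfileSolutionOnPos
  have p₃ := h₃.isProfileSolutionOnPos
  by_cases hex : ∃ r, 0 < r ∧ φ₂ r = φ₃ r
  · obtain ⟨r, hr, h⟩ := hex
    exact p₂.eqOn_of_touch p₃ h23 hr h
  · push Not at hex
    exact absurd (le_of_lt_of_tendsto hN p₁ p₂ p₃ (fun r hr => (h23 r hr).lt_of_ne (hex r hr))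
      (tendsto_diffWronskian_zero h₁.1 h₂.1 h₃) h₁.2 h₂.2) h12

/-- For a singular upper solution the Wronskian takes a nonnegative value. -/
theorem exists_diffWronskian_nonneg {N : ℕ} {φ₁ φ₂ φ₃ : ℝ → ℝ}
    (h₁ : IsProfileSolutionOnPos N φ₁) (h₂ : IsProfileSolutionOnPos N φ₂)
    (h₃ : IsProfileSolutionOnPos N φ₃) (h12 : ∀ r, 0 < r → φ₁ r < φ₂ r) {a₁ a₂ : ℝ}
    (l₁ : Tendsto φ₁ (𝓝[>] 0) (𝓝 a₁)) (l₂ : Tendsto φ₂ (𝓝[>] 0) (𝓝 a₂))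
    (l₃ : Tendsto φ₃ (𝓝[>] 0) atTop) :
    ∃ r, 0 < r ∧ 0 ≤ diffWronskian N φ₁ φ₂ φ₃ r := by
  by_contra! hneg
  -- `q' = -W / (ρ w ^ 2)`, so negative `W` makes `q` monotone and `q ≤ q 1` on `(0, 1]`.
  set q : ℝ → ℝ := fun x => (φ₃ x - φ₂ x) / (φ₂ x - φ₁ x) with hq
  have hw : ∀ r, 0 < r → 0 < φ₂ r - φ₁ r := fun r hr => sub_pos.2 (h12 r hr)
  have hd : ∀ r, 0 < r → HasDerivAt q (((deriv φ₃ r - deriv φ₂ r) * (φ₂ r - φ₁ r) -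
      (φ₃ r - φ₂ r) * (deriv φ₂ r - deriv φ₁ r)) / (φ₂ r - φ₁ r) ^ 2) r := fun r hr =>
    ((h₃ r hr).1.sub (h₂ r hr).1).div ((h₂ r hr).1.sub (h₁ r hr).1) (hw r hr).ne'
  have hmono : MonotoneOn q (Set.Ioi 0) := by
    refine monotoneOn_of_deriv_nonneg (convex_Ioi 0)
      (fun r hr => (hd r hr).continuousAt.continuousWithinAt)
      (fun r hr => (hd r (interior_subset hr)).differentiableAt.differentiableWithinAt) ?_
    intro r hr
    have hr0 : 0 < r := interior_subset hr
    rw [(hd r hr0).deriv]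
    refine div_nonneg ?_ (sq_nonneg _)
    have := neg_of_mul_neg_right (hneg r hr0) (profileWeight_pos N hr0).le
    linarith
  have hev : ∀ᶠ r in 𝓝[>] (0 : ℝ), φ₃ r ≤ φ₂ r + q 1 * (φ₂ r - φ₁ r) := by
    filter_upwards [Ioc_mem_nhdsGT (zero_lt_one' ℝ)] with r hr
    have h1 : q r ≤ q 1 := hmono hr.1 (Set.mem_Ioi.2 one_pos) hr.2
    have h2 : φ₃ r - φ₂ r ≤ q 1 * (φ₂ r - φ₁ r) := (div_le_iff₀ (hw r hr.1)).1 h1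
    linarith
  exact not_tendsto_nhds_of_tendsto_atTop (tendsto_atTop_mono' _ hev l₃) _
    (l₂.add ((l₂.sub l₁).const_mul (q 1)))

theorem mainTheorem4 (N : ℕ) (hN : 1 ≤ N) (L : ℝ) (φmin φL : ℝ → ℝ)
    (hmin : IsMinimalSolution N L φmin) (hφL : φL ∈ solutionSet N L)
    (hne : ∃ r : ℝ, 0 ≤ r ∧ φmin r ≠ φL r) :
    (∀ φ ∈ solutionSet N L, (∀ r : ℝ, 0 < r → φ r ≤ φL r) →
      (∀ r : ℝ, 0 < r → φ r = φmin r) ∨ (∀ r : ℝ, 0 < r → φ r = φL r)) ∧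
    (∀ φ : ℝ → ℝ, IsRegularSolution N φ → (∀ r : ℝ, 0 ≤ r → φL r ≤ φ r) →
      ∀ r : ℝ, 0 ≤ r → φ r = φL r) ∧
    (∀ L₀ : ℝ, L₀ ≤ L → ∀ φ ∈ solutionSet N L₀, (∀ r : ℝ, 0 ≤ r → φ r ≤ φmin r) →
      IsMinimalSolution N L₀ φ) ∧
    (¬ ∃ φ : ℝ → ℝ, IsSingularSolution N φ ∧ ∀ r : ℝ, 0 < r → φL r < φ r) := by
  obtain ⟨hminS, hminle⟩ := hmin
  have hlt : ∀ r, 0 < r → φmin r < φL r := by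
    intro r hr
    refine (hminle φL hφL r hr.le).lt_of_ne fun heq => ?_
    have hall := hminS.1.isProfileSolutionOnPos.eqOn_of_touch hφL.1.isProfileSolutionOnPos
      (fun x hx => hminle φL hφL x hx.le) hr heq
    obtain ⟨x, hx, hxne⟩ := hne
    rcases hx.eq_or_lt with rfl | hx
    · exact hxne (hminS.1.zero_eq hφL.1 hall)
    · exact hxne (hall x hx)
  refine ⟨?_, ?_, ?_, ?_⟩
  · intro φ hφ hle
    by_cases h : ∀ r, 0 < r → φ r ≤ φmin r
    · exact Or.inl fun r hr => (h r hr).antisymm (hminle φ hφ r hr.le)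
    · exact Or.inr (eq_of_le_of_not_le hN hminS hφ hφL.1 hle h)
  · intro φ hφ hle
    have heq := eq_of_le_of_not_le hN hminS hφL hφ (fun r hr => hle r hr.le)
      fun h => not_le.2 (hlt 1 one_pos) (h 1 one_pos)
    intro r hr
    rcases hr.eq_or_lt with rfl | hr
    · exact (hφL.1.zero_eq hφ heq).symm
    · exact (heq r hr).symm
  · intro L₀ hL₀ φ hφ hle
    refine ⟨hφ, fun ψ hψ => ?_⟩
    rcases hL₀.eq_or_lt with rfl | hL₀
    · exact fun r hr => (hle r hr).trans (hminle ψ hψ r hr)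
    · have hpos : ∀ r, 0 < r → φ r ≤ ψ r := by
        by_contra hnot
        -- With `φmin` as the upper solution, failure of minimality would give `φ = φmin`, hence `L₀
        -- = L`.
        have heq := eq_of_le_of_not_le hN hψ hφ hminS.1 (fun r hr => hle r hr.le) hnot
        refine hL₀.ne (tendsto_nhds_unique hφ.2 (hminS.2.congr' ?_))
        filter_upwards [eventually_gt_atTop 0] with r hr
        rw [heq r hr]
      intro r hr
      rcases hr.eq_or_lt with rfl | hr
      · exact hφ.1.zero_le hψ.1 hpos
      · exact hpos r hr
  · rintro ⟨φ, hφ, hgt⟩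
    have p₁ := hminS.1.isProfileSolutionOnPos
    have p₂ := hφL.1.isProfileSolutionOnPos
    have p₃ := hφ.isProfileSolutionOnPos
    obtain ⟨r, hr, hW⟩ := exists_diffWronskian_nonneg p₁ p₂ p₃ hlt hminS.1.tendsto_zero
      hφL.1.tendsto_zero hφ.tendsto_zero
    exact not_lt.2 hW (diffWronskian_neg hN p₁ p₂ p₃ hr (fun x hx => hlt x (hr.trans_le hx))
      (fun x hx => hgt x (hr.trans_le hx)) hminS.2 hφL.2)
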